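/- Let $n=2k+1$ be an odd positive integer. Let $\mathrm{Spin}(n)$ be the spin group, contained in the Clifford algebra of $\mathbb{R}^n$ with the relations $v^2=-\|v\|^2$. Let $\Delta_n=\mathbb{C}^2\otimes\cdots\otimes\mathbb{C}^2$ ($k$ factors) be the complex spinor space, on which the Clifford algebra acts through $$e_{2j-1}\mapsto 1\otimes\cdots\otimes 1\otimes g_1\otimes \underbrace{T\otimes\cdots\otimes T}_{j-1},\qquad e_{2j}\mapsto 1\otimes\cdots\otimes 1\otimes g_2\otimes \underbrace{T\otimes\cdots\otimes T}_{j-1}\qquad(1\le j\le k),$$ $$e_{2k+1}\mapsto i\,T\otimes\cdots\otimes T,$$ where $g_1=\begin{pmatrix} i&0\\0&-i\end{pmatrix}$, $g_2=\begin{pmatrix}0&i\\ i&0\end{pmatrix}$, $T=\begin{pmatrix}0&-i\\ i&0\end{pmatrix}$. Let $\kappa:\mathrm{Spin}(n)\to GL(\Delta_n)$ be the restriction of this action (the spin representation). Let $$\mathrm{Spin}^T(n)=(\mathrm{Spin}(n)\times S^1\times S^1)/\{\pm1\},$$ where $\{\pm 1\}=\{(1,1,1),(-1,-1,-1)\}$,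 and write $[g,z_1,z_2]$ for the class of $(g,z_1,z_2)$. Let $\kappa^T$ be the (well defined) representation of $\mathrm{Spin}^T(n)$ on $\Delta_n$ given by $$\kappa^T[g,z_1,z_2]\psi=z_1^2z_2\,\kappa(g)\psi .$$ Then $\kappa^T$ is irreducible: $\Delta_n\neq 0$, and the only complex linear subspaces of $\Delta_n$ invariant under $\mathrm{Spin}^T(n)$ are $0$ and $\Delta_n$. -/

import Mathlib

noncomputable section

namespace SpinRep

/-! ### The groups `Spin(n)` and `Spin^T(n)` -/

/-- The negative definite quadratic form `v ↦ -(v₁² + ⋯ + vₙ²)` on `ℝⁿ`. -/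
abbrev form (n : ℕ) : QuadraticForm ℝ (Fin n → ℝ) :=
  QuadraticMap.weightedSumSquares ℝ (fun _ : Fin n => (-1 : ℝ))

/-- The real Clifford algebra of `ℝⁿ`, in which `v² = -‖v‖²`. -/
abbrev Cl (n : ℕ) : Type := CliffordAlgebra (form n)

/-- The group `Spin(n)`, inside the Clifford algebra. -/
abbrev Spin (n : ℕ) : Type := spinGroup (form n)

/-- The subgroup `{±1} = {(1, 1, 1), (-1, -1, -1)}` of `Spin(n) × S¹ × S¹`. -/
def signSubgroup (n : ℕ) : Subgroup (Spin n × Circle × Circle) where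
  carrier := {x | x = 1 ∨
    ((x.1 : Cl n) = -1 ∧ (x.2.1 : ℂ) = -1 ∧ (x.2.2 : ℂ) = -1)}
  one_mem' := Or.inl rfl
  mul_mem' := by
    rintro a b (rfl | ⟨h1, h2, h3⟩) (rfl | ⟨k1, k2, k3⟩)
    · left; simp
    · right; simpa using ⟨k1, k2, k3⟩
    · right; simpa using ⟨h1, h2, h3⟩
    · left
      refine Prod.ext (Subtype.ext ?_) (Prod.ext (Circle.ext ?_) (Circle.ext ?_))
      · simp [h1, k1]
      · simp [h2, k2]
      · simp [h3, k3]
  inv_mem' := by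
    rintro a (rfl | ⟨h1, h2, h3⟩)
    · left; simp
    · right
      refine ⟨?_, ?_, ?_⟩
      · change star (a.1 : Cl n) = -1
        rw [h1]; simp
      · simp [h2]
      · simp [h3]

instance signSubgroup_normal (n : ℕ) : (signSubgroup n).Normal where
  conj_mem := by
    rintro a (rfl | ⟨h1, h2, h3⟩) g
    · left; simp
    · right
      have hg : ((g.1 : Spin n) : Cl n) * ((g.1⁻¹ : Spin n) : Cl n) = 1 :=
        spinGroup.coe_mul_star_self g.1
      refine ⟨?_, ?_, ?_⟩
      · simp [h1, hg]
      · simp [h2]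
      · simp [h3]

/-- `Spin^T(n) = (Spin(n) × S¹ × S¹) / {±1}`. -/
abbrev SpinT (n : ℕ) : Type := (Spin n × Circle × Circle) ⧸ signSubgroup n

/-- The class `[g, z₁, z₂]`. -/
abbrev SpinT.mk {n : ℕ} (g : Spin n) (z₁ z₂ : Circle) : SpinT n :=
  QuotientGroup.mk (g, z₁, z₂)

/-! ### Spinors -/

/-- The index set of the standard basis `e_{s 0} ⊗ ⋯ ⊗ e_{s (k-1)}` of the `k`-fold tensor product
`ℂ² ⊗ ⋯ ⊗ ℂ²`, where `k = ⌊n/2⌋`. -/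
abbrev Idx (n : ℕ) : Type := Fin (n / 2) → Fin 2

/-- The space `Δₙ = ℂ² ⊗ ⋯ ⊗ ℂ²` of complex spinors, with `⌊n/2⌋` factors, in coordinates with
respect to the standard basis; its dimension is `2 ^ ⌊n/2⌋`. -/
abbrev Spinor (n : ℕ) : Type := Idx n → ℂ

/-- The Kronecker product `M 0 ⊗ ⋯ ⊗ M (k-1)`, `k = ⌊n/2⌋`, as an endomorphism of
`ℂ² ⊗ ⋯ ⊗ ℂ²` written as a matrix in the standard basis. -/
def tensorMatrix (n : ℕ) (M : ℕ → Matrix (Fin 2) (Fin 2) ℂ) : Matrix (Idx n) (Idx n) ℂ :=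
  fun s t => ∏ r : Fin (n / 2), M r (s r) (t r)

/-- The matrix `g₁ = diag(i, -i)`. -/
def g₁ : Matrix (Fin 2) (Fin 2) ℂ := !![Complex.I, 0; 0, -Complex.I]

/-- The matrix `g₂` with both off-diagonal entries `i`. -/
def g₂ : Matrix (Fin 2) (Fin 2) ℂ := !![0, Complex.I; Complex.I, 0]

/-- The matrix `T = i g₁ g₂`. -/
def T : Matrix (Fin 2) (Fin 2) ℂ := !![0, -Complex.I; Complex.I, 0]

/-- The matrix by which the (0-based) basis vector `e_a` acts on the `r`-th factor `ℂ²`: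
`T` for `r < ⌊a/2⌋`, `g₁` or `g₂` (according to the parity of `a`) for `r = ⌊a/2⌋`, and
the identity for `r > ⌊a/2⌋`. -/
def site (a r : ℕ) : Matrix (Fin 2) (Fin 2) ℂ :=
  if r < a / 2 then T else if r = a / 2 then (if a % 2 = 0 then g₁ else g₂) else 1

/-- The scalar `1`, except that it is `i` for the last basis vector when `n` is odd. -/
def phase (n a : ℕ) : ℂ := if a / 2 < n / 2 then 1 else Complex.I

/-- Clifford multiplication by the (0-based) basis vector `e_a` on `Δₙ`. With the tensor factors
written from right to left, the basis vectors number `2j` and `2j+1` act as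
`1 ⊗ ⋯ ⊗ 1 ⊗ g₁ ⊗ T ⊗ ⋯ ⊗ T` and `1 ⊗ ⋯ ⊗ 1 ⊗ g₂ ⊗ T ⊗ ⋯ ⊗ T`, with `j` factors `T`;
for odd `n` the last basis vector acts as `i T ⊗ ⋯ ⊗ T`. -/
def gamma (n : ℕ) (a : Fin n) : Matrix (Idx n) (Idx n) ℂ :=
  phase n a • tensorMatrix n (site a)

theorem tensorMatrix_mul (n : ℕ) (A B : ℕ → Matrix (Fin 2) (Fin 2) ℂ) :
    tensorMatrix n A * tensorMatrix n B = tensorMatrix n fun r => A r * B r := by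
  ext s t
  simp only [tensorMatrix, Matrix.mul_apply, ← Finset.prod_mul_distrib, Finset.prod_univ_sum,
    Fintype.piFinset_univ]

theorem tensorMatrix_smul (n : ℕ) (c : ℕ → ℂ) (A : ℕ → Matrix (Fin 2) (Fin 2) ℂ) :
    tensorMatrix n (fun r => c r • A r) = (∏ r : Fin (n / 2), c r) • tensorMatrix n A := by
  ext s t
  simp [tensorMatrix, Finset.prod_mul_distrib]

theorem tensorMatrix_one (n : ℕ) : tensorMatrix n (fun _ => 1) = 1 := by
  ext s t
  simp [tensorMatrix, Matrix.one_apply, Finset.prod_ite_zero, funext_iff]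

theorem prod_sign (k j : ℕ) :
    (∏ r : Fin k, if (r : ℕ) = j then (-1 : ℂ) else 1) = if j < k then -1 else 1 := by
  rw [Fin.prod_univ_eq_prod_range (fun r => if r = j then (-1 : ℂ) else 1) k,
    Finset.prod_ite_eq']
  simp

theorem g₁_sq : g₁ * g₁ = -1 := by
  ext i j; fin_cases i <;> fin_cases j <;> simp [g₁, Matrix.mul_apply]

theorem g₂_sq : g₂ * g₂ = -1 := by
  ext i j; fin_cases i <;> fin_cases j <;> simp [g₂, Matrix.mul_apply]

theorem T_sq : T * T = 1 := by
  ext i j; fin_cases i <;> fin_cases j <;> simp [T, Matrix.mul_apply]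

theorem g₁_mul_g₂ : g₁ * g₂ = -(g₂ * g₁) := by
  ext i j; fin_cases i <;> fin_cases j <;> simp [g₁, g₂, Matrix.mul_apply]

theorem g₁_mul_T : g₁ * T = -(T * g₁) := by
  ext i j; fin_cases i <;> fin_cases j <;> simp [g₁, T, Matrix.mul_apply]

theorem g₂_mul_T : g₂ * T = -(T * g₂) := by
  ext i j; fin_cases i <;> fin_cases j <;> simp [g₂, T, Matrix.mul_apply]

theorem site_sq (a r : ℕ) :
    site a r * site a r = (if r = a / 2 then (-1 : ℂ) else 1) • 1 := by
  unfold site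
  split_ifs <;> first | omega | simp [T_sq, g₁_sq, g₂_sq]

theorem site_mul (a b r : ℕ) (h : a < b) :
    site a r * site b r = (if r = a / 2 then (-1 : ℂ) else 1) • (site b r * site a r) := by
  unfold site
  split_ifs <;> first | omega | simp [g₁_mul_g₂, g₁_mul_T, g₂_mul_T]

theorem gamma_sq (n : ℕ) (a : Fin n) : gamma n a * gamma n a = -1 := by
  have h := tensorMatrix_mul n (site a) (site a)
  simp only [site_sq] at h
  rw [tensorMatrix_smul n (fun r => if r = (a : ℕ) / 2 then (-1 : ℂ) else 1), prod_sign,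
    tensorMatrix_one] at h
  rw [gamma, smul_mul_smul_comm, h, smul_smul, phase]
  split_ifs <;> simp

theorem gamma_mul_of_lt (n : ℕ) {a b : Fin n} (hab : a < b) :
    gamma n a * gamma n b = -(gamma n b * gamma n a) := by
  have hlt : (a : ℕ) / 2 < n / 2 := by have := b.isLt; have : (a : ℕ) < b := hab; omega
  have h := tensorMatrix_mul n (site a) (site b)
  simp only [site_mul a b _ hab] at h
  rw [tensorMatrix_smul n (fun r => if r = (a : ℕ) / 2 then (-1 : ℂ) else 1), prod_sign,
    if_pos hlt, ← tensorMatrix_mul] at h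
  rw [gamma, gamma, smul_mul_smul_comm, smul_mul_smul_comm, h, mul_comm (phase n b), neg_one_smul,
    smul_neg]

theorem gamma_mul (n : ℕ) {a b : Fin n} (hab : a ≠ b) :
    gamma n a * gamma n b = -(gamma n b * gamma n a) := by
  rcases lt_or_gt_of_ne hab with h | h
  · exact gamma_mul_of_lt n h
  · rw [gamma_mul_of_lt n h, neg_neg]

/-- Clifford multiplication by vectors of `ℝⁿ` on spinors. -/
def cliffordMul (n : ℕ) : (Fin n → ℝ) →ₗ[ℝ] Matrix (Idx n) (Idx n) ℂ where
  toFun v := ∑ a, (v a : ℂ) • gamma n a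
  map_add' v w := by simp [add_smul, Finset.sum_add_distrib]
  map_smul' c v := by
    simp only [Pi.smul_apply, smul_eq_mul, Complex.ofReal_mul, mul_smul, RingHom.id_apply,
      Finset.smul_sum]
    refine Finset.sum_congr rfl fun a _ => ?_
    exact Complex.coe_smul c _

theorem cliffordMul_sq (n : ℕ) (v : Fin n → ℝ) :
    cliffordMul n v * cliffordMul n v = algebraMap ℝ _ (form n v) := by
  have key : ∀ a b : Fin n, ((v a : ℂ) • gamma n a) * ((v b : ℂ) • gamma n b) +
      ((v b : ℂ) • gamma n b) * ((v a : ℂ) • gamma n a) =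
      if a = b then (-2 * (v a * v a) : ℂ) • (1 : Matrix (Idx n) (Idx n) ℂ) else 0 := by
    intro a b
    rw [smul_mul_smul_comm, smul_mul_smul_comm]
    split_ifs with h
    · subst h
      rw [gamma_sq, smul_neg, ← neg_smul, ← add_smul]
      congr 1; ring
    · rw [gamma_mul n h, mul_comm (v b : ℂ), smul_neg, neg_add_cancel]
  have h2 : (2 : ℂ) • (cliffordMul n v * cliffordMul n v) =
      (2 : ℂ) • algebraMap ℝ (Matrix (Idx n) (Idx n) ℂ) (form n v) := by
    have e : cliffordMul n v * cliffordMul n v =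
        ∑ a, ∑ b, ((v a : ℂ) • gamma n a) * ((v b : ℂ) • gamma n b) := by
      change (∑ a, (v a : ℂ) • gamma n a) * (∑ a, (v a : ℂ) • gamma n a) = _
      rw [Finset.sum_mul_sum]
    have e' : cliffordMul n v * cliffordMul n v =
        ∑ a, ∑ b, ((v b : ℂ) • gamma n b) * ((v a : ℂ) • gamma n a) := by
      rw [e, Finset.sum_comm]
    rw [two_smul]
    nth_rewrite 1 [e]
    rw [e', ← Finset.sum_add_distrib]
    simp_rw [← Finset.sum_add_distrib, key]
    simp only [Finset.sum_ite_eq, Finset.mem_univ, if_true]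
    rw [← Finset.sum_smul, Algebra.algebraMap_eq_smul_one,
      ← Complex.coe_smul (form n v) (1 : Matrix (Idx n) (Idx n) ℂ), smul_smul]
    congr 1
    simp [Finset.mul_sum]
  exact smul_right_injective _ (two_ne_zero (α := ℂ)) h2

/-- The action of the Clifford algebra on spinors. For odd `n` its complexification is one of the
two irreducible representations of the complex Clifford algebra, and for even `n` it is the
irreducible one. -/
def cliffordAction (n : ℕ) : Cl n →ₐ[ℝ] Matrix (Idx n) (Idx n) ℂ :=
  CliffordAlgebra.lift (form n) ⟨cliffordMul n, cliffordMul_sq n⟩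

/-- The spin representation `κ` of `Spin(n)` on `Δₙ`. -/
def kappa (n : ℕ) : Representation ℂ (Spin n) (Spinor n) :=
  ((Matrix.toLinAlgEquiv' : Matrix (Idx n) (Idx n) ℂ ≃ₐ[ℂ] Module.End ℂ (Spinor n)) :
    Matrix (Idx n) (Idx n) ℂ →* Module.End ℂ (Spinor n)).comp
    ((cliffordAction n : Cl n →* Matrix (Idx n) (Idx n) ℂ).comp (spinGroup (form n)).subtype)

/-- The map `(g, z₁, z₂) ↦ z₁² z₂ κ(g)` on `Spin(n) × S¹ × S¹`. -/
def kappaTLift (n : ℕ) : Representation ℂ (Spin n × Circle × Circle) (Spinor n) where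
  toFun x := ((x.2.1 : ℂ) ^ 2 * (x.2.2 : ℂ)) • kappa n x.1
  map_one' := by simp
  map_mul' x y := by
    simp only [Prod.fst_mul, Prod.snd_mul, Circle.coe_mul, map_mul, smul_mul_smul_comm]
    congr 1; ring

/-- The representation `κ^T` of `Spin^T(n)` on `Δₙ`: `κ^T[g, z₁, z₂]ψ = z₁² z₂ κ(g)ψ`. -/
def kappaT (n : ℕ) : Representation ℂ (SpinT n) (Spinor n) :=
  QuotientGroup.lift (signSubgroup n) (kappaTLift n) (by
    rintro x (rfl | ⟨h1, h2, h3⟩)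
    · exact map_one _
    · change ((x.2.1 : ℂ) ^ 2 * (x.2.2 : ℂ)) •
        Matrix.toLinAlgEquiv' (cliffordAction n (x.1 : Cl n)) = 1
      rw [h1, h2, h3, map_neg, map_neg, map_one, map_one]
      simp)

theorem kappaT_mk (n : ℕ) (g : Spin n) (z₁ z₂ : Circle) (ψ : Spinor n) :
    kappaT n (SpinT.mk g z₁ z₂) ψ = ((z₁ : ℂ) ^ 2 * (z₂ : ℂ)) • kappa n g ψ :=
  rfl

end SpinRep

end

namespace SpinRep

/-! ### Products of two basis vectors in `Spin(n)` -/

/-! Every product `e_a e_b` of basis vectors lies in Spin(n), so an invariant subspace is stable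
under the complex algebra generated by the matrices `gamma n a * gamma n b`. For odd `n` this
algebra is the full matrix algebra (`eq_top_of_gamma_mul_mem`): pairs within one factor give `T` on
that factor, and the last vector, acting by `T` on every factor, lets one isolate `g₁` as well.
Since `g₁` and `T` generate the 2×2 matrices, all elementary tensors follow, hence all matrix units.
Rank-one matrices then carry any nonzero spinor to any other. -/

theorem form_single (n : ℕ) (a : Fin n) : form n (Pi.single a 1) = -1 := by
  simp [form, QuadraticMap.weightedSumSquares_apply, Pi.single_apply]

/-- The image of the basis vector `e_a` in the Clifford algebra. -/
def basisVec (n : ℕ) (a : Fin n) : Cl n := CliffordAlgebra.ι (form n) (Pi.single a 1)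

theorem basisVec_sq (n : ℕ) (a : Fin n) : basisVec n a * basisVec n a = -1 := by
  rw [basisVec, CliffordAlgebra.ι_sq_scalar, form_single, map_neg, map_one]

/-- The basis vector `e_a` as a unit of the Clifford algebra. -/
def basisUnit (n : ℕ) (a : Fin n) : (Cl n)ˣ where
  val := basisVec n a
  inv := -basisVec n a
  val_inv := by rw [mul_neg, basisVec_sq, neg_neg]
  inv_val := by rw [neg_mul, basisVec_sq, neg_neg]

theorem star_basisVec (n : ℕ) (a : Fin n) : star (basisVec n a) = -basisVec n a :=
  CliffordAlgebra.star_ι _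

/-- A basis vector is a generator of the Lipschitz group, and its star `-e_a` is its inverse. -/
theorem basisVec_mem_pinGroup (n : ℕ) (a : Fin n) : basisVec n a ∈ pinGroup (form n) := by
  rw [pinGroup.mem_iff]
  refine ⟨⟨basisUnit n a, Subgroup.subset_closure ⟨_, rfl⟩, rfl⟩, ?_⟩
  rw [Unitary.mem_iff, star_basisVec, neg_mul, mul_neg, basisVec_sq, neg_neg]
  exact ⟨rfl, rfl⟩

theorem basisVec_mul_mem_spinGroup (n : ℕ) (a b : Fin n) :
    basisVec n a * basisVec n b ∈ spinGroup (form n) :=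
  spinGroup.mem_iff.2 ⟨mul_mem (basisVec_mem_pinGroup n a) (basisVec_mem_pinGroup n b),
    CliffordAlgebra.ι_mul_ι_mem_evenOdd_zero _ _ _⟩

theorem cliffordAction_basisVec (n : ℕ) (a : Fin n) :
    cliffordAction n (basisVec n a) = gamma n a := by
  rw [cliffordAction, basisVec, CliffordAlgebra.lift_ι_apply]
  change ∑ b, ((Pi.single a 1 : Fin n → ℝ) b : ℂ) • gamma n b = _
  rw [Finset.sum_eq_single a]
  · simp
  · intro b _ hb
    simp [Pi.single_eq_of_ne hb]
  · simp

/-! ### Operators on a single tensor factor -/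

/-- The operator `m` on the `j`-th factor `ℂ²`, as a linear function of `m`. -/
def slot (n : ℕ) (j : Fin (n / 2)) :
    Matrix (Fin 2) (Fin 2) ℂ →ₗ[ℂ] Matrix (Idx n) (Idx n) ℂ where
  toFun m := tensorMatrix n fun r => if r = j then m else 1
  map_add' x y := by
    ext s t
    simp only [tensorMatrix, Matrix.add_apply]
    simp only [← Finset.mul_prod_erase Finset.univ _ (Finset.mem_univ j), if_true,
      Matrix.add_apply, add_mul]
    congr 2 <;>
    · refine Finset.prod_congr rfl fun r hr => ?_
      have : (r : ℕ) ≠ j := fun h => (Finset.mem_erase.1 hr).1 (Fin.ext h)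
      simp [this]
  map_smul' c x := by
    ext s t
    simp only [tensorMatrix, Matrix.smul_apply, RingHom.id_apply]
    simp only [← Finset.mul_prod_erase Finset.univ _ (Finset.mem_univ j), if_true,
      Matrix.smul_apply, smul_eq_mul, mul_assoc]
    congr 2
    refine Finset.prod_congr rfl fun r hr => ?_
    have : (r : ℕ) ≠ j := fun h => (Finset.mem_erase.1 hr).1 (Fin.ext h)
    simp [this]

theorem slot_apply (n : ℕ) (j : Fin (n / 2)) (m : Matrix (Fin 2) (Fin 2) ℂ) :
    slot n j m = tensorMatrix n fun r => if r = j then m else 1 := rfl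

theorem slot_mul (n : ℕ) (j : Fin (n / 2)) (x y : Matrix (Fin 2) (Fin 2) ℂ) :
    slot n j (x * y) = slot n j x * slot n j y := by
  rw [slot_apply, slot_apply, slot_apply, tensorMatrix_mul]
  congr 1
  ext1 r
  split_ifs <;> simp

theorem slot_one (n : ℕ) (j : Fin (n / 2)) : slot n j 1 = 1 := by
  rw [slot_apply, ← tensorMatrix_one]
  simp

/-- Families of factors are indexed by ℕ, but only the first `n / 2` entries are read. -/
theorem tensorMatrix_congr (n : ℕ) {A B : ℕ → Matrix (Fin 2) (Fin 2) ℂ}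
    (h : ∀ r < n / 2, A r = B r) : tensorMatrix n A = tensorMatrix n B := by
  ext s t
  exact Finset.prod_congr rfl fun r _ => by rw [h r r.isLt]

/-- A subalgebra contains `M 0 ⊗ ⋯ ⊗ M (k-1)` as soon as it contains each `M j` acting on the
`j`-th factor. -/
theorem tensorMatrix_mem (n : ℕ) (S : Subalgebra ℂ (Matrix (Idx n) (Idx n) ℂ))
    (M : ℕ → Matrix (Fin 2) (Fin 2) ℂ) (h : ∀ j : Fin (n / 2), slot n j (M j) ∈ S) :
    tensorMatrix n M ∈ S := by
  -- The factors are filled in one at a time, the identity standing in for those not yet reached.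
  have key : ∀ j ≤ n / 2, tensorMatrix n (fun r => if r < j then M r else 1) ∈ S := by
    intro j
    induction j with
    | zero => intro _; simp [tensorMatrix_one]
    | succ j ih =>
      intro hj
      convert mul_mem (ih (by omega)) (h ⟨j, hj⟩) using 1
      rw [slot_apply, tensorMatrix_mul]
      congr 1
      ext1 r
      dsimp only
      split_ifs <;> first | omega | simp_all
  convert key _ le_rfl using 1
  exact tensorMatrix_congr n fun r hr => by rw [if_pos hr]

theorem exists_eq_combination (m : Matrix (Fin 2) (Fin 2) ℂ) :
    ∃ a b c d : ℂ, m = a • 1 + b • g₁ + c • T + d • (g₁ * T) := by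
  -- `1` and `g₁` span the diagonal matrices; `T` and `g₁ * T`, which is the swap matrix, span the
  -- off-diagonal ones.
  refine ⟨(m 0 0 + m 1 1) / 2, (m 1 1 - m 0 0) / 2 * Complex.I, (m 0 1 - m 1 0) / 2 * Complex.I,
    (m 0 1 + m 1 0) / 2, ?_⟩
  ext i j
  fin_cases i <;> fin_cases j <;> simp [g₁, T] <;>
    ring_nf <;> simp only [Complex.I_sq] <;> ring

theorem slot_mem (n : ℕ) (S : Subalgebra ℂ (Matrix (Idx n) (Idx n) ℂ)) (j : Fin (n / 2))
    (h₁ : slot n j g₁ ∈ S) (hT : slot n j T ∈ S) (m : Matrix (Fin 2) (Fin 2) ℂ) :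
    slot n j m ∈ S := by
  obtain ⟨a, b, c, d, rfl⟩ := exists_eq_combination m
  simp only [map_add, map_smul, slot_one, slot_mul]
  exact add_mem (add_mem (add_mem (S.smul_mem (one_mem S) a) (S.smul_mem h₁ b))
    (S.smul_mem hT c)) (S.smul_mem (mul_mem h₁ hT) d)

theorem single_eq_tensorMatrix (n : ℕ) (s t : Idx n) :
    Matrix.single s t (1 : ℂ) = tensorMatrix n fun r =>
      if h : r < n / 2 then Matrix.single (s ⟨r, h⟩) (t ⟨r, h⟩) 1 else 1 := by
  ext s' t'
  simp only [tensorMatrix, Fin.is_lt, dite_true, Fin.eta, Matrix.single_apply, Finset.prod_ite_zero,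
    Finset.prod_const_one, Finset.mem_univ, true_implies, forall_and, funext_iff]

/-! ### The even part of the Clifford algebra generates all matrices for odd `n` -/

theorem phase_ne_zero (n a : ℕ) : phase n a ≠ 0 := by
  unfold phase
  split_ifs <;> simp

theorem site_mul_mem (n : ℕ) (S : Subalgebra ℂ (Matrix (Idx n) (Idx n) ℂ))
    (h : ∀ a b : Fin n, gamma n a * gamma n b ∈ S) (a b : Fin n) :
    tensorMatrix n (fun r => site a r * site b r) ∈ S := by
  have := h a b
  rw [gamma, gamma, smul_mul_smul_comm, tensorMatrix_mul] at this
  have h0 := mul_ne_zero (phase_ne_zero n a) (phase_ne_zero n b)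
  have h1 := S.smul_mem this (phase n a * phase n b)⁻¹
  rwa [smul_smul, inv_mul_cancel₀ h0, one_smul] at h1

theorem g₁_mul_g₂_eq : g₁ * g₂ = (-Complex.I) • T := by
  ext i j
  fin_cases i <;> fin_cases j <;> simp [g₁, g₂, T, Matrix.mul_apply]

/-- In the product of vectors `2j` and `2j + 1` the factors below `j` are `T * T = 1`, those above
are `1`, and factor `j` is `g₁ * g₂ = -i T`. -/
theorem slot_T_mem (n : ℕ) (S : Subalgebra ℂ (Matrix (Idx n) (Idx n) ℂ))
    (h : ∀ a b : Fin n, gamma n a * gamma n b ∈ S) (j : Fin (n / 2)) : slot n j T ∈ S := by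
  have hj := j.isLt
  have h1 := site_mul_mem n S h ⟨2 * j, by omega⟩ ⟨2 * j + 1, by omega⟩
  have h2 : slot n j ((-Complex.I) • T) ∈ S := by
    convert h1 using 1
    rw [slot_apply, ← g₁_mul_g₂_eq]
    congr 1
    ext1 r
    simp only [site]
    split_ifs <;> first | omega | simp [T_sq]
  rw [map_smul] at h2
  simpa [smul_smul] using S.smul_mem h2 Complex.I

/-- Oddness enters here: vector `2k` has `T` in every factor. Its product with vector `2j` is `1`
below factor `j`, `g₁ * T` at `j` and `T` above, and the copies of `T` from `j` on are cancelled by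
`slot_T_mem`. -/
theorem slot_g₁_mem {n : ℕ} (hn : Odd n) (S : Subalgebra ℂ (Matrix (Idx n) (Idx n) ℂ))
    (h : ∀ a b : Fin n, gamma n a * gamma n b ∈ S) (j : Fin (n / 2)) : slot n j g₁ ∈ S := by
  have hj := j.isLt
  obtain ⟨k, rfl⟩ := hn
  have h1 := site_mul_mem _ S h ⟨2 * j, by omega⟩ ⟨2 * k, by omega⟩
  have h2 := tensorMatrix_mem _ S (fun r => if r < j then 1 else T) fun i => by
    split_ifs
    · rw [slot_one]; exact one_mem S
    · exact slot_T_mem _ S h i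
  convert mul_mem h1 h2 using 1
  rw [slot_apply, tensorMatrix_mul]
  refine tensorMatrix_congr _ fun r hr => ?_
  simp only [site]
  split_ifs <;> first | omega | simp [T_sq, mul_assoc]

theorem eq_top_of_gamma_mul_mem {n : ℕ} (hn : Odd n)
    (S : Subalgebra ℂ (Matrix (Idx n) (Idx n) ℂ))
    (h : ∀ a b : Fin n, gamma n a * gamma n b ∈ S) : S = ⊤ := by
  refine Algebra.eq_top_iff.2 fun A => ?_
  rw [Matrix.matrix_eq_sum_single A]
  refine sum_mem fun s _ => sum_mem fun t _ => ?_
  rw [← mul_one (A s t), ← smul_eq_mul, ← Matrix.smul_single, single_eq_tensorMatrix]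
  exact S.smul_mem (tensorMatrix_mem n S _ fun j =>
    slot_mem n S j (slot_g₁_mem hn S h j) (slot_T_mem n S h j) _) _

/-- The matrices that map a subspace `W` of the spinor space to itself. -/
def stabilizer {n : ℕ} (W : Submodule ℂ (Spinor n)) :
    Subalgebra ℂ (Matrix (Idx n) (Idx n) ℂ) where
  carrier := {A | ∀ ψ ∈ W, A.mulVec ψ ∈ W}
  mul_mem' hA hB ψ hψ := by
    rw [← Matrix.mulVec_mulVec]
    exact hA _ (hB _ hψ)
  add_mem' hA hB ψ hψ := by
    rw [Matrix.add_mulVec]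
    exact W.add_mem (hA _ hψ) (hB _ hψ)
  algebraMap_mem' c ψ hψ := by
    rw [Algebra.algebraMap_eq_smul_one, Matrix.smul_mulVec, Matrix.one_mulVec]
    exact W.smul_mem c hψ

theorem eq_bot_or_eq_top_of_stabilizer {n : ℕ} (W : Submodule ℂ (Spinor n))
    (h : stabilizer W = ⊤) : W = ⊥ ∨ W = ⊤ := by
  refine or_iff_not_imp_left.2 fun hW => ?_
  obtain ⟨ψ, hψ, h0⟩ := W.ne_bot_iff.1 hW
  obtain ⟨s, hs⟩ := Function.ne_iff.1 h0
  refine W.eq_top_iff'.2 fun φ => ?_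
  -- This rank-one matrix reads off coordinate `s`, normalised by `ψ s`, and so sends `ψ` to `φ`.
  have hA : Matrix.vecMulVec φ (Pi.single s (ψ s)⁻¹) ∈ stabilizer W := h ▸ Algebra.mem_top
  have := hA ψ hψ
  rw [Matrix.vecMulVec_mulVec, single_dotProduct, inv_mul_cancel₀ hs] at this
  simpa using this

end SpinRep

/-- For odd `n`, the representation `κ^T` of `Spin^T(n)` on the spinor space is irreducible. -/
theorem mainTheorem4 (n : ℕ) (hn : Odd n) : (SpinRep.kappaT n).IsIrreducible := by
  have hnt : Nontrivial (Subrepresentation (SpinRep.kappaT n)) :=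
    ⟨⊥, ⊤, fun h => bot_ne_top (α := Submodule ℂ (SpinRep.Spinor n))
      (congrArg Subrepresentation.toSubmodule h)⟩
  refine { hnt with eq_bot_or_eq_top := fun W => ?_ }
  have hW : SpinRep.stabilizer W.toSubmodule = ⊤ := by
    refine SpinRep.eq_top_of_gamma_mul_mem hn _ fun a b ψ hψ => ?_
    -- Taking `z₁ = z₂ = 1` makes the scalar `z₁² z₂` trivial.
    have h := W.apply_mem_toSubmodule
      (SpinRep.SpinT.mk ⟨_, SpinRep.basisVec_mul_mem_spinGroup n a b⟩ 1 1) hψ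
    rw [SpinRep.kappaT_mk] at h
    simp only [Circle.coe_one, one_pow, mul_one, one_smul] at h
    change (SpinRep.cliffordAction n
      (SpinRep.basisVec n a * SpinRep.basisVec n b)).mulVec ψ ∈ _ at h
    rwa [map_mul, SpinRep.cliffordAction_basisVec, SpinRep.cliffordAction_basisVec] at h
  exact (SpinRep.eq_bot_or_eq_top_of_stabilizer _ hW).imp
    (fun h => Subrepresentation.toSubmodule_injective h)
    (fun h => Subrepresentation.toSubmodule_injective h)
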